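/- Let $G$ be a finite group. For $u=\sum_{g\in G}\alpha_g g\in\mathbb{Z}G$ and $y\in G$ let $\nu_y(u)=\sum_{g\in y^G}\alpha_g$, where $y^G$ is the conjugacy class of $y$ in $G$, and let $V(\mathbb{Z}G)$ be the group of units $\sum_{g}\alpha_g g$ of $\mathbb{Z}G$ with $\sum_g\alpha_g=1$. Write $x\sim y$ if $x$ and $y$ are conjugate in $G$, and let $\mu$ be the Möbius function. Let $u\in V(\mathbb{Z}G)$ be a torsion unit, of finite order $|u|$, and let $k$ and $n$ be positive integers such that $k$ is coprime to the exponent of $G$ and both $k$ and $n$ are congruent to $1$ modulo $|u|$. Then for every $s\in G$ $$\nu_s(u)=\sum_{r\mid t\mid n}\mu(r)\sum_{x^G}\nu_x(u),$$ where the outer sum is over all pairs of positive integers $(r,t)$ with $r\mid t$ and $t\mid n$, and the inner sum is over those conjugacy classes $x^G$ of $G$ for which $x^k\sim s$ and there exists $y\in G$ with $y^{knr/t}=x^k$ (conditions that do not depend on the choice of $x$ in its class). -/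

import Mathlib

/-- The augmentation `∑ α_g g ↦ ∑ α_g` of the group ring `K[G]`, as a `K`-algebra homomorphism. -/
noncomputable def augmentation (K G : Type*) [CommRing K] [Group G] :
    MonoidAlgebra K G →ₐ[K] K :=
  MonoidAlgebra.lift K K G 1

theorem augmentation_apply {K G : Type*} [CommRing K] [Group G] (u : MonoidAlgebra K G) :
    augmentation K G u = ∑ g ∈ u.coeff.support, u.coeff g := by
  simp [augmentation, MonoidAlgebra.lift_apply, Finsupp.sum]

/-- The normalized group of units `V(KG)`: the units `∑ α_g g` of `KG` with `∑ α_g = 1`. -/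
def normalizedUnits (K G : Type*) [CommRing K] [Group G] : Subgroup (MonoidAlgebra K G)ˣ where
  carrier := {u | augmentation K G (u : MonoidAlgebra K G) = 1}
  one_mem' := by simp
  mul_mem' := by
    intro a b ha hb
    simp only [Set.mem_setOf_eq] at ha hb ⊢
    simp [ha, hb]
  inv_mem' := by
    intro a ha
    simp only [Set.mem_setOf_eq] at ha ⊢
    have h : augmentation K G ((a : MonoidAlgebra K G) * (a⁻¹ : (MonoidAlgebra K G)ˣ)) = 1 := by
      simp
    rwa [map_mul, ha, one_mul] at h

/-- The partial augmentation `ν_y(u) = ∑_{g ∈ y^G} α_g` of `u = ∑ α_g g`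
(a sum with only finitely many non-zero terms). -/
noncomputable def partialAugmentation {K G : Type*} [CommRing K] [Group G]
    (y : G) (u : MonoidAlgebra K G) : K :=
  ∑ᶠ g ∈ {g : G | IsConj y g}, u.coeff g

theorem partialAugmentation_congr {K G : Type*} [CommRing K] [Group G] {x y : G}
    (h : IsConj x y) (u : MonoidAlgebra K G) :
    partialAugmentation x u = partialAugmentation y u := by
  have hs : {g : G | IsConj x g} = {g : G | IsConj y g} :=
    Set.ext fun g => ⟨fun hg => h.symm.trans hg, fun hg => h.trans hg⟩
  simp only [partialAugmentation, hs]

/-- The common value of `ν_x(u)` for all `x` in a conjugacy class. -/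
noncomputable def classAugmentation {K G : Type*} [CommRing K] [Group G]
    (C : ConjClasses G) (u : MonoidAlgebra K G) : K :=
  Quotient.liftOn C (fun x => partialAugmentation x u)
    fun _ _ h => partialAugmentation_congr h u

/-!
The Möbius sum telescopes. Substituting `m = (n / t) r`, so that `r` runs over the divisors of
the divisor `m` of `n`, turns it into `∑_{m ∣ n} (∑_{r ∣ m} μ(r)) F(m)`, where `F(m)` is the sum
of `ν_x(u)` over the classes with `x ^ k ∼ s` and `x ^ k` a `k m`-th power
(`sum_moebius_mul_div_mul`). Only `m = 1` survives. As `k` is coprime to the exponent of `G`,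
`x ↦ x ^ k` is a bijection of `G` that commutes with conjugation, so `F(1) = ν_x(u)` for any `x`
with `x ^ k = s`.

It remains to see `ν_s(u) = ν_x(u)`. For a prime `p` and any `v ∈ ℤG`,
`ν_s(v ^ p) ≡ ∑_{g ^ p ∼ s} v_g` modulo `p` (`partialAugmentation_pow_prime`): expand `v ^ p` as a
sum over `p`-tuples; `ν_s` vanishes on commutators, so cyclic rotation of the tuples preserves
the terms, and modulo `p` only the constant tuples contribute. By Dirichlet's theorem there are
arbitrarily large primes `p` congruent to `k` modulo `|u|` times the exponent of `G`. For these
`u ^ p = u` and `g ^ p = g ^ k`, so `ν_s(u) ≡ ν_x(u)` modulo arbitrarily large primes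
(`partialAugmentation_pow_eq`).
-/

/-- If an iterate `f ^ p` of a self-map is the identity, with `p` prime, then a sum of an
`f`-invariant function with values in `ZMod p` reduces to the fixed points of `f`. -/
theorem sum_eq_sum_fixed_of_iterate_prime {X : Type*} [Fintype X] [DecidableEq X] {p : ℕ}
    [hp : Fact p.Prime] (f : X → X) (hf : f^[p] = id) (w : X → ZMod p) (hw : ∀ x, w (f x) = w x) :
    ∑ x, w x = ∑ x with f x = x, w x := by
  classical
  rw [← Finset.sum_fiberwise Finset.univ w w, ← Finset.sum_fiberwise (Finset.univ.filter _) w w]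
  refine Finset.sum_congr rfl fun v _ => ?_
  rw [Finset.sum_congr rfl (g := fun _ => v) (by simp),
    Finset.sum_congr (s₁ := Finset.filter _ (Finset.filter _ _)) rfl (g := fun _ => v) (by simp)]
  simp only [Finset.sum_const, nsmul_eq_mul]
  congr 1
  rw [ZMod.natCast_eq_natCast_iff]
  let φ : Function.End {x // w x = v} := fun x => ⟨f x, (hw _).trans x.2⟩
  have hφ : ∀ (n : ℕ) (x : {x // w x = v}), (((φ ^ n) x : {x // w x = v}) : X) = f^[n] x := by
    intro n
    induction n with
    | zero => intro x; rfl
    | succ n ih =>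
      intro x
      rw [pow_succ, Function.iterate_succ_apply]
      exact ih (φ x)
  have h1 : φ ^ p ^ 1 = 1 := by
    funext x
    apply Subtype.ext
    rw [pow_one, hφ, hf]
    rfl
  have h := Equiv.Perm.card_fixedPoints_modEq h1
  rw [Fintype.card_subtype] at h
  convert h using 1
  symm
  refine Fintype.card_of_bijective (f := fun y => (⟨(y.1 : X), by
    have := congrArg Subtype.val y.2.eq
    simpa using ⟨this, y.1.2⟩⟩ : {x // x ∈ ({x ∈ {x | f x = x} | w x = v} : Finset X)})) ?_
    |>.trans (Fintype.card_coe _)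
  constructor
  · intro a b hab
    simpa [Subtype.ext_iff] using hab
  · rintro ⟨x, hx⟩
    simp only [Finset.mem_filter, Finset.mem_univ, true_and] at hx
    exact ⟨⟨⟨x, hx.2⟩, Subtype.ext hx.1⟩, rfl⟩

theorem sum_pow_eq_sum_prod_ofFn {A ι : Type*} [Semiring A] [Fintype ι] (a : ι → A) (m : ℕ) :
    (∑ i, a i) ^ m = ∑ f : Fin m → ι, (List.ofFn fun j => a (f j)).prod := by
  induction m with
  | zero => simp
  | succ m ih =>
    rw [pow_succ', ih, Finset.sum_mul_sum, ← Finset.sum_product', Finset.univ_product_univ]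
    exact Fintype.sum_equiv (Fin.consEquiv fun _ => ι) _ _ fun x => by
      simp [Fin.consEquiv, List.ofFn_succ]

/-- A trace form to `ZMod p` satisfies the "freshman's dream" `T ((∑ aᵢ) ^ p) = ∑ T (aᵢ ^ p)`. -/
theorem map_sum_pow_prime_of_trace {A ι : Type*} [Ring A] [Fintype ι] {p : ℕ} [Fact p.Prime]
    (T : A →+ ZMod p) (hT : ∀ a b, T (a * b) = T (b * a)) (a : ι → A) :
    T ((∑ i, a i) ^ p) = ∑ i, T (a i ^ p) := by
  classical
  obtain ⟨m, rfl⟩ : ∃ m, p = m + 1 := ⟨p - 1, by have := (Fact.out : p.Prime).pos; omega⟩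
  rw [sum_pow_eq_sum_prod_ofFn, map_sum]
  rw [sum_eq_sum_fixed_of_iterate_prime (fun f : Fin (m + 1) → ι => fun j => f (j + 1))]
  · have hfix : ∀ f : Fin (m + 1) → ι, (fun j => f (j + 1)) = f → f = fun _ => f 0 := by
      intro f hf
      funext j
      induction j using Fin.induction with
      | zero => rfl
      | succ j ih => rw [← ih, ← Fin.coeSucc_eq_succ]; exact congrFun hf _
    symm
    refine Finset.sum_bij' (fun i _ => fun _ => i) (fun f _ => f 0) ?_ ?_ ?_ ?_ ?_
    · intro i _; simp
    · intro f _; simp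
    · intro i _; rfl
    · intro f hf
      exact (hfix f (by simpa using hf)).symm
    · intro i _; simp [pow_succ']
  · have hit : ∀ (n : ℕ) (f : Fin (m + 1) → ι),
        (fun f : Fin (m + 1) → ι => fun j => f (j + 1))^[n] f
          = fun j => f (j + n • (1 : Fin (m + 1))) := by
      intro n
      induction n with
      | zero => intro f; simp
      | succ n ih =>
        intro f
        rw [Function.iterate_succ_apply, ih]
        funext j
        rw [add_assoc, ← succ_nsmul]
    have hcycle : (m + 1) • (1 : Fin (m + 1)) = 0 := by
      simpa using card_nsmul_eq_zero' (G := Fin (m + 1)) (x := 1)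
    funext f
    rw [hit, hcycle]
    simp
  · intro f
    rw [List.ofFn_succ', List.ofFn_succ (f := fun j => a (f j))]
    simp only [List.concat_eq_append, List.prod_append, List.prod_cons, List.prod_nil, mul_one]
    rw [hT]
    simp [Fin.coeSucc_eq_succ]

theorem partialAugmentation_eq_sum {K G : Type*} [CommRing K] [Group G] [Fintype G]
    [DecidableRel (IsConj : G → G → Prop)] (s : G) (u : MonoidAlgebra K G) :
    partialAugmentation s u = ∑ g, if IsConj s g then u.coeff g else 0 := by
  classical
  rw [partialAugmentation, ← Finset.sum_filter, ← finsum_mem_coe_finset]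
  simp

/-- The partial augmentation `ν_s` as an additive map. -/
noncomputable def partialAugmentationHom (K : Type*) {G : Type*} [CommRing K] [Group G] [Finite G]
    (s : G) : MonoidAlgebra K G →+ K :=
  AddMonoidHom.mk' (partialAugmentation s) fun a b => by
    classical
    have := Fintype.ofFinite G
    simp only [partialAugmentation_eq_sum, ← Finset.sum_add_distrib]
    refine Finset.sum_congr rfl fun g _ => ?_
    split_ifs <;> simp

@[simp]
theorem partialAugmentationHom_apply {K G : Type*} [CommRing K] [Group G] [Finite G]
    (s : G) (u : MonoidAlgebra K G) :
    partialAugmentationHom K s u = partialAugmentation s u := rfl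

theorem partialAugmentation_single {K G : Type*} [CommRing K] [Group G] [Finite G]
    [DecidableRel (IsConj : G → G → Prop)] (s g : G) (c : K) :
    partialAugmentation s (MonoidAlgebra.single g c) = if IsConj s g then c else 0 := by
  classical
  have := Fintype.ofFinite G
  rw [partialAugmentation_eq_sum, Finset.sum_eq_single g]
  · simp
  · intro h _ hh
    simp [Finsupp.single_eq_of_ne hh]
  · simp

theorem MonoidAlgebra.eq_sum_univ_single {K G : Type*} [CommRing K] [Group G] [Fintype G]
    (u : MonoidAlgebra K G) : u = ∑ g, MonoidAlgebra.single g (u.coeff g) := by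
  conv_lhs => rw [← MonoidAlgebra.sum_coeff_single u]
  exact Finsupp.sum_fintype _ _ (by simp)

theorem partialAugmentation_mul_comm {K G : Type*} [CommRing K] [Group G] [Finite G]
    (s : G) (a b : MonoidAlgebra K G) :
    partialAugmentation s (a * b) = partialAugmentation s (b * a) := by
  classical
  have := Fintype.ofFinite G
  have hconj : ∀ g h : G, IsConj s (g * h) ↔ IsConj s (h * g) := fun g h => by
    have : IsConj (g * h) (h * g) := isConj_iff.2 ⟨h, by group⟩
    exact ⟨fun hs => hs.trans this, fun hs => hs.trans this.symm⟩
  rw [MonoidAlgebra.eq_sum_univ_single a, MonoidAlgebra.eq_sum_univ_single b,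
    Finset.sum_mul_sum, Finset.sum_mul_sum, Finset.sum_comm]
  simp only [← partialAugmentationHom_apply, map_sum]
  simp only [partialAugmentationHom_apply, MonoidAlgebra.single_mul_single,
    partialAugmentation_single, hconj, mul_comm]

/-- Modulo a prime `p`, the `p`-th power map of `ℤG` acts on partial augmentations as if it were
additive. -/
theorem partialAugmentation_pow_prime {G : Type*} [Group G] [Fintype G]
    [DecidableRel (IsConj : G → G → Prop)] (p : ℕ) [Fact p.Prime] (s : G)
    (v : MonoidAlgebra ℤ G) :
    ((partialAugmentation s (v ^ p) : ℤ) : ZMod p)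
      = ((∑ g, if IsConj s (g ^ p) then v.coeff g else 0 : ℤ) : ZMod p) := by
  let T : MonoidAlgebra ℤ G →+ ZMod p :=
    (Int.castAddHom (ZMod p)).comp (partialAugmentationHom ℤ s)
  have h := map_sum_pow_prime_of_trace T
    (fun a b => congrArg (Int.cast : ℤ → ZMod p) (partialAugmentation_mul_comm s a b))
    (fun g => MonoidAlgebra.single g (v.coeff g))
  rw [← MonoidAlgebra.eq_sum_univ_single v] at h
  refine h.trans ?_
  rw [Int.cast_sum]
  refine Finset.sum_congr rfl fun g _ => ?_
  -- Fermat's little theorem removes the exponent `p` from the coefficient.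
  simp [T, MonoidAlgebra.single_pow, partialAugmentation_single, apply_ite Int.cast]

theorem pow_left_injective_of_coprime_exponent {G : Type*} [Group G] [Finite G] {k : ℕ}
    (hk : k.Coprime (Monoid.exponent G)) : Function.Injective fun x : G => x ^ k := by
  obtain ⟨m, hm⟩ := Nat.exists_mul_mod_eq_of_coprime 1 hk Monoid.exponent_ne_zero_of_finite
  have h : ∀ x : G, (x ^ k) ^ m = x := fun x => by
    rw [← pow_mul, Monoid.pow_eq_mod_exponent, hm.2, ← Monoid.pow_eq_mod_exponent, pow_one]
  intro x y hxy
  rw [← h x, ← h y]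
  exact congrArg (· ^ m) hxy

theorem isConj_pow_iff_of_coprime_exponent {G : Type*} [Group G] [Finite G] {k : ℕ}
    (hk : k.Coprime (Monoid.exponent G)) {x y : G} : IsConj (x ^ k) (y ^ k) ↔ IsConj x y := by
  refine ⟨fun h => ?_, fun h => h.pow k⟩
  obtain ⟨c, hc⟩ := isConj_iff.1 h
  rw [← conj_pow] at hc
  exact isConj_iff.2 ⟨c, pow_left_injective_of_coprime_exponent hk hc⟩

theorem partialAugmentation_pow_eq {G : Type*} [Group G] [Finite G] {v : MonoidAlgebra ℤ G}
    {k m : ℕ} (hm : m ≠ 0) (hv : v ^ m = 1) (hk : k.Coprime (Monoid.exponent G))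
    (hkm : k ≡ 1 [MOD m]) (x : G) :
    partialAugmentation (x ^ k) v = partialAugmentation x v := by
  classical
  have := Fintype.ofFinite G
  have hcop : k.Coprime (Monoid.exponent G * m) :=
    hk.mul_right (by rw [Nat.Coprime, hkm.gcd_eq, Nat.gcd_one_left])
  obtain ⟨p, hpgt, hp, hpk⟩ := Nat.forall_exists_prime_gt_and_modEq
    (partialAugmentation (x ^ k) v - partialAugmentation x v).natAbs
    (mul_ne_zero Monoid.exponent_ne_zero_of_finite hm) hcop
  have := Fact.mk hp
  have hvp : v ^ p = v := by
    have h1 : p ≡ 1 [MOD m] := (hpk.of_mul_left _).trans hkm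
    rw [← pow_mod_orderOf, Nat.ModEq.of_dvd (orderOf_dvd_of_pow_eq_one hv) h1, pow_mod_orderOf,
      pow_one]
  have hgp : ∀ g : G, g ^ p = g ^ k := fun g => by
    rw [Monoid.pow_eq_mod_exponent, hpk.of_mul_right _, ← Monoid.pow_eq_mod_exponent]
  have h := partialAugmentation_pow_prime p (x ^ k) v
  simp only [hvp, hgp, isConj_pow_iff_of_coprime_exponent hk, ← partialAugmentation_eq_sum] at h
  have hdvd := (ZMod.intCast_eq_intCast_iff_dvd_sub _ _ p).1 h.symm
  refine sub_eq_zero.1 (Int.eq_zero_of_abs_lt_dvd hdvd ?_)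
  rw [Int.abs_eq_natAbs]
  exact_mod_cast hpgt

/-- The double Möbius sum collapses to its value at `1`: for fixed `m = (n / t) r` the weights
`μ(r)` add up over all `r ∣ m`. -/
theorem sum_moebius_mul_div_mul {n : ℕ} (hn : n ≠ 0) (F : ℕ → ℤ) :
    ∑ t ∈ n.divisors, ∑ r ∈ t.divisors, ArithmeticFunction.moebius r * F (n / t * r) = F 1 := by
  have hswap : ∑ t ∈ n.divisors, ∑ r ∈ t.divisors, ArithmeticFunction.moebius r * F (n / t * r)
      = ∑ m ∈ n.divisors, ∑ r ∈ m.divisors, ArithmeticFunction.moebius r * F m := by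
    have hmem : ∀ x : (_ : ℕ) × ℕ, x ∈ n.divisors.sigma (fun t => t.divisors) →
        (⟨n / x.1 * x.2, x.2⟩ : (_ : ℕ) × ℕ) ∈ n.divisors.sigma (fun t => t.divisors) ∧
          n / (n / x.1 * x.2) * x.2 = x.1 := by
      rintro ⟨t, r⟩ hx
      simp only [Finset.mem_sigma, Nat.mem_divisors] at hx ⊢
      obtain ⟨⟨⟨d, rfl⟩, -⟩, ⟨q, rfl⟩, -⟩ := hx
      have hr : 0 < r := Nat.pos_of_ne_zero fun h => hn (by simp [h])
      have hq : 0 < q := Nat.pos_of_ne_zero fun h => hn (by simp [h])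
      have hd : 0 < d := Nat.pos_of_ne_zero fun h => hn (by simp [h])
      rw [Nat.mul_div_cancel_left _ (Nat.mul_pos hr hq)]
      refine ⟨⟨⟨⟨q, by ring⟩, hn⟩, ⟨d, by ring⟩, (Nat.mul_pos hd hr).ne'⟩, ?_⟩
      rw [show r * q * d = q * (d * r) by ring, Nat.mul_div_cancel _ (Nat.mul_pos hd hr)]
      ring
    rw [Finset.sum_sigma', Finset.sum_sigma']
    refine Finset.sum_bij' (fun x _ => ⟨n / x.1 * x.2, x.2⟩) (fun x _ => ⟨n / x.1 * x.2, x.2⟩)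
      (fun x hx => (hmem x hx).1) (fun x hx => (hmem x hx).1) ?_ ?_ (fun _ _ => rfl)
    · rintro ⟨t, r⟩ hx
      exact Sigma.ext (hmem _ hx).2 HEq.rfl
    · rintro ⟨t, r⟩ hx
      exact Sigma.ext (hmem _ hx).2 HEq.rfl
  rw [hswap, Finset.sum_eq_single 1]
  · simp
  · intro m _ hm
    rw [← Finset.sum_mul, ← ArithmeticFunction.coe_mul_zeta_apply,
      ArithmeticFunction.moebius_mul_coe_zeta, ArithmeticFunction.one_apply_ne hm, zero_mul]
  · simp [hn]

theorem theorem1 {G : Type*} [Group G] [Finite G] (u : normalizedUnits ℤ G)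
    (hu : IsOfFinOrder u) (k n : ℕ) (hk : 0 < k) (hn : 0 < n)
    (hke : Nat.Coprime k (Monoid.exponent G))
    (hn1 : n ≡ 1 [MOD orderOf u]) (hk1 : k ≡ 1 [MOD orderOf u]) (s : G) :
    partialAugmentation s ((u : (MonoidAlgebra ℤ G)ˣ) : MonoidAlgebra ℤ G) =
      ∑ t ∈ n.divisors, ∑ r ∈ t.divisors, ArithmeticFunction.moebius r *
        ∑ᶠ C ∈ {C : ConjClasses G |
            ∃ x : G, ConjClasses.mk x = C ∧
              (∃ y : G, y ^ (k * n * r / t) = x ^ k) ∧ IsConj (x ^ k) s},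
          classAugmentation C ((u : (MonoidAlgebra ℤ G)ˣ) : MonoidAlgebra ℤ G) := by
  obtain ⟨x, rfl⟩ := Finite.surjective_of_injective (pow_left_injective_of_coprime_exponent hke) s
  set v : MonoidAlgebra ℤ G := ((u : (MonoidAlgebra ℤ G)ˣ) : MonoidAlgebra ℤ G) with hv
  have hvpow : v ^ orderOf u = 1 := by
    rw [hv, ← Units.val_pow_eq_pow_val, ← Subgroup.coe_pow, pow_orderOf_eq_one]
    simp
  let F : ℕ → ℤ := fun m => ∑ᶠ C ∈ {C : ConjClasses G | ∃ z : G, ConjClasses.mk z = C ∧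
    (∃ y : G, y ^ (k * m) = z ^ k) ∧ IsConj (z ^ k) (x ^ k)}, classAugmentation C v
  have hF : F 1 = partialAugmentation x v := by
    have hset : {C : ConjClasses G | ∃ z : G, ConjClasses.mk z = C ∧
        (∃ y : G, y ^ (k * 1) = z ^ k) ∧ IsConj (z ^ k) (x ^ k)} = {ConjClasses.mk x} := by
      ext C
      simp only [isConj_pow_iff_of_coprime_exponent hke, Set.mem_ofPred_eq,
        Set.mem_singleton_iff, mul_one]
      constructor
      · rintro ⟨z, rfl, -, hz⟩
        exact ConjClasses.mk_eq_mk_iff_isConj.2 hz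
      · rintro rfl
        exact ⟨x, rfl, ⟨x, rfl⟩, IsConj.refl x⟩
    simp only [F, hset, finsum_mem_singleton]
    rfl
  have hsum := sum_moebius_mul_div_mul hn.ne' F
  rw [hF, ← partialAugmentation_pow_eq hu.orderOf_pos.ne' hvpow hke hk1 x] at hsum
  rw [← hsum]
  refine Finset.sum_congr rfl fun t ht => Finset.sum_congr rfl fun r _ => ?_
  have hdiv : k * n * r / t = k * (n / t * r) := by
    rw [show k * n * r = k * r * n by ring, Nat.mul_div_assoc _ (Nat.dvd_of_mem_divisors ht)]
    ring
  rw [hdiv]
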